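/- Let $n\ge 1$, $\omega=e^{2\pi i/n}$, and let $W=(\omega^{rs})_{r,s\in\mathbb Z_n}$ be the discrete Fourier matrix of $\mathbb Z_n$. For $g\in\mathbb C^{\mathbb Z_n}$ and $x\in\mathbb Z_n$ let $D_{x,g}$ be the diagonal matrix with entry $g(y+x)$ at position $y\in\mathbb Z_n$, and let $$A_{\mathbb Z_n,g}=\bigl(D_{0,g}W\,|\,D_{1,g}W\,|\,\cdots\,|\,D_{n-1,g}W\bigr)^{*}$$ be the full Gabor system matrix, the adjoint of an $n\times n^2$ matrix whose columns are indexed by pairs $(x,\xi)\in\mathbb Z_n\times\mathbb Z_n$ of a translation $x$ (the block) and a modulation $\xi$ (the column within the block). A minor of $A_{\mathbb Z_n,g}$ of size $k$ is given by $k$ such pairs and $k$ positions $y\in\mathbb Z_n$; the chosen pairs are called its (Gabor) columns, although after taking the adjoint they index rows. Call a subset of $\mathbb Z_n$ adjacent if it is empty or consists of cyclically consecutive residues $a,a+1,\dots,a+l-1$ modulo $n$. (1) Consider any minor, of any size, such that for each translation $x$ the set of modulations $\xi$ for which $(x,\xi)$ is one of its columns is adjacent. This minor is nonzero for (Lebesgue-)almost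 every $g\in\mathbb C^{\mathbb Z_n}$. (2) Consider any minor of size $n\times n$ such that for each modulation $\xi$ the set of translations $x$ for which $(x,\xi)$ is one of its columns is adjacent. This minor is nonzero for almost every $g\in\mathbb C^{\mathbb Z_n}$. -/

import Mathlib

namespace FiniteGabor

open Matrix

noncomputable section

/-- The discrete Fourier matrix `W = (ω ^ (r s))` of the cyclic group of order `n`, where
`ω = exp (2 π i / n)` and rows and columns are labelled by residues. -/
def fourierMatrix (n : ℕ) : Matrix (ZMod n) (ZMod n) ℂ :=
  Matrix.of fun r s => Complex.exp (2 * Real.pi * Complex.I / n) ^ (r.val * s.val)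

/-- The diagonal matrix `D_{x,g}` whose entry at position `y` is `g (y + x)`. -/
def shiftDiagonal {n : ℕ} (x : ZMod n) (g : ZMod n → ℂ) : Matrix (ZMod n) (ZMod n) ℂ :=
  Matrix.diagonal fun y => g (y + x)

/-- The `n × n²` block matrix `(D_{0,g} W | D_{1,g} W | ⋯ | D_{n-1,g} W)`; its column `(x, ξ)` is
column `ξ` of the block `D_{x,g} W`, that is, `x` is the translation and `ξ` the modulation. -/
def gaborColumns {n : ℕ} [NeZero n] (g : ZMod n → ℂ) :
    Matrix (ZMod n) (ZMod n × ZMod n) ℂ :=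
  Matrix.of fun y p => (shiftDiagonal p.1 g * fourierMatrix n) y p.2

/-- The full Gabor system matrix (short-time Fourier transform matrix) with window `g`: the
adjoint of the block matrix `gaborColumns g`. -/
def gaborMatrix {n : ℕ} [NeZero n] (g : ZMod n → ℂ) :
    Matrix (ZMod n × ZMod n) (ZMod n) ℂ :=
  (gaborColumns g)ᴴ

/-- A set of residues modulo `n` is adjacent if it is a (possibly empty, possibly wrapping) run
`a, a + 1, …, a + (l - 1)` of consecutive residues. -/
def IsAdjacent {n : ℕ} (S : Set (ZMod n)) : Prop :=
  ∃ (a : ZMod n) (l : ℕ), S = {s | ∃ j < l, s = a + (j : ZMod n)}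

end

end FiniteGabor

namespace FiniteGabor

open Matrix Polynomial

/-! A minor is, up to conjugation, a polynomial in `g`, so one window with nonzero minor suffices
(`ae_det_ne_zero_of_exists`). For (1), take `g z = t ^ 2 ^ z.val` and regard the minor as a
polynomial in `t`: each Leibniz term is a monomial whose exponent is the weight of the assignment of
translations to positions. All assignments of maximal weight coincide
(`assignment_eq_of_weight_max`), so the top coefficient is, after reordering, block diagonal with
one Fourier minor per translation. Adjacent modulations make each block a Vandermonde matrix up to
nonzero factors (`det_block_ne_zero`). For (2), the Fourier transform exchanges translations and
modulations and reduces the claim to (1). -/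

theorem gaborColumns_apply {n : ℕ} [NeZero n] (g : ZMod n → ℂ) (y x ξ : ZMod n) :
    gaborColumns g y (x, ξ) = g (y + x) * ZMod.stdAddChar (y * ξ) := by
  have h : ZMod.stdAddChar (y * ξ)
      = Complex.exp (2 * Real.pi * Complex.I / n) ^ (y.val * ξ.val) := by
    have := ZMod.stdAddChar_coe (N := n) ((y.val * ξ.val : ℕ) : ℤ)
    rw [← Complex.exp_nat_mul]
    convert this using 2
    · push_cast
      rw [ZMod.natCast_zmod_val, ZMod.natCast_zmod_val]
    · push_cast
      ring
  simp [gaborColumns, shiftDiagonal, fourierMatrix, Matrix.diagonal_mul, h]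

theorem det_gaborMatrix_submatrix {n : ℕ} [NeZero n] {ι : Type*} [Fintype ι] [DecidableEq ι]
    (g : ZMod n → ℂ) (c : ι → ZMod n × ZMod n) (r : ι → ZMod n) :
    ((gaborMatrix g).submatrix c r).det = star ((gaborColumns g).submatrix r c).det := by
  rw [← Matrix.det_conjTranspose]
  rfl

theorem IsAdjacent.exists_val_sub_lt_iff {n : ℕ} [NeZero n] {S : Set (ZMod n)}
    (hS : IsAdjacent S) : ∃ (a : ZMod n) (l : ℕ), l ≤ n ∧ ∀ s, s ∈ S ↔ (s - a).val < l := by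
  obtain ⟨a, l, rfl⟩ := hS
  refine ⟨a, min l n, min_le_right _ _, fun s => ⟨?_, fun h => ?_⟩⟩
  · rintro ⟨j, hj, rfl⟩
    rw [add_sub_cancel_left, lt_min_iff]
    refine ⟨lt_of_le_of_lt ?_ hj, ZMod.val_lt _⟩
    rw [ZMod.val_natCast]
    exact Nat.mod_le _ _
  · exact ⟨(s - a).val, h.trans_le (min_le_left _ _), by simp⟩

/-! ### From one good window to almost every window -/

/-- A determinant of a matrix pencil `A + t B` with `det B ≠ 0` vanishes for finitely many `t`. -/
theorem finite_setOf_det_add_smul_eq_zero {ι K : Type*} [Fintype ι] [DecidableEq ι] [Field K]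
    (A B : Matrix ι ι K) (hB : B.det ≠ 0) : {t : K | (A + t • B).det = 0}.Finite := by
  classical
  set P : K[X] := det ((X : K[X]) • B.map C + A.map C)
  have hP : P ≠ 0 := by
    intro h
    apply hB
    rw [← Polynomial.coeff_det_X_add_C_card B A]
    change P.coeff _ = 0
    rw [h, coeff_zero]
  refine (P.roots.toFinset.finite_toSet).subset fun t ht => ?_
  simp only [Finset.mem_coe, Multiset.mem_toFinset, mem_roots hP, IsRoot.def]
  change evalRingHom t P = 0
  rw [RingHom.map_det, ← (ht : (A + t • B).det = 0)]
  congr 1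
  ext i j
  simp [add_comm (A i j), mul_comm t]

/-- On each line in direction `g₀` the determinant is a polynomial with leading coefficient `(L
g₀).det`, so its zeros there are finite in number; Fubini concludes. -/
theorem ae_det_ne_zero_of_exists {ι κ : Type*} [Fintype ι] [DecidableEq ι] [Fintype κ]
    (L : (κ → ℂ) →ₗ[ℂ] Matrix ι ι ℂ) (g₀ : κ → ℂ) (h₀ : (L g₀).det ≠ 0) :
    ∀ᵐ g : κ → ℂ ∂MeasureTheory.volume, (L g).det ≠ 0 := by
  have hc : Continuous fun g => (L g).det :=
    (L.continuous_of_finiteDimensional).matrix_det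
  have hs : MeasurableSet {g : κ → ℂ | (L g).det ≠ 0} :=
    (isOpen_ne_fun hc continuous_const).measurableSet
  refine MeasureTheory.ae_mem_of_ae_add_linearMap_mem (LinearMap.toSpanSingleton ℂ (κ → ℂ) g₀)
    MeasureTheory.volume MeasureTheory.volume hs fun y => ?_
  have hf := finite_setOf_det_add_smul_eq_zero (L y) (L g₀) h₀
  have := hf.countable.ae_notMem (MeasureTheory.volume : MeasureTheory.Measure ℂ)
  filter_upwards [this] with t ht
  change (L (y + t • g₀)).det ≠ 0
  rw [map_add, map_smul]
  exact ht

/-! ### The Vandermonde blocks -/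

/-- Columns of a Gabor system restricted to the positions assigned to their own translation. -/
theorem det_block_ne_zero {n : ℕ} [NeZero n] {ι : Type*} [Fintype ι] [DecidableEq ι]
    (x ξ r : ι → ZMod n) (hc : Function.Injective fun i => (x i, ξ i))
    (hr : Function.Injective r)
    (hadj : ∀ b, IsAdjacent {s | (b, s) ∈ Set.range fun i => (x i, ξ i)})
    (σ : Equiv.Perm ι) :
    (Matrix.of fun i j => if x (σ j) = x i then ZMod.stdAddChar (r j * ξ i) else 0 :
      Matrix ι ι ℂ).det ≠ 0 := by
  intro hdet
  obtain ⟨v, hv, hvN⟩ := Matrix.exists_vecMul_eq_zero_iff.2 hdet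
  apply hv
  funext i₀
  obtain ⟨a, l, hl, hS⟩ := (hadj (x i₀)).exists_val_sub_lt_iff
  set b := x i₀
  let B : Finset ι := Finset.univ.filter fun i => x i = b
  let d : ι → ℕ := fun i => (ξ i - a).val
  have hdl : ∀ i ∈ B, d i < l := fun i hi =>
    (hS (ξ i)).1 ⟨i, by simp [(Finset.mem_filter.1 hi).2]⟩
  have hdinj : Set.InjOn d B := by
    intro i hi j hj hij
    have h1 : ξ i = ξ j := sub_left_injective (ZMod.val_injective n hij)
    have h2 : x i = x j :=
      (Finset.mem_filter.1 hi).2.trans (Finset.mem_filter.1 hj).2.symm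
    exact hc (Prod.ext h2 h1)
  have hcard : l ≤ B.card := by
    have hsub : Finset.range l ⊆ B.image d := by
      intro k hk
      have hk' : k < l := Finset.mem_range.1 hk
      have hval : ((a + (k : ZMod n)) - a).val = k := by
        rw [add_sub_cancel_left, ZMod.val_natCast_of_lt (hk'.trans_le hl)]
      obtain ⟨i, hi⟩ := (hS (a + k)).2 (by rw [hval]; exact hk')
      obtain ⟨h1, h2⟩ := Prod.mk.inj hi
      exact Finset.mem_image.2 ⟨i, Finset.mem_filter.2 ⟨Finset.mem_univ _, h1⟩, by
        simp only [d, h2, hval]⟩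
    simpa using (Finset.card_le_card hsub).trans Finset.card_image_le
  -- The part of the kernel relation in block `b`, with the common frequency `a` factored out:
  -- degree below `l ≤ B.card`, yet it vanishes at `B.card` distinct roots of unity.
  let p : ℂ[X] := ∑ i ∈ B, monomial (d i) (v i)
  have hp : p = 0 := by
    refine Polynomial.eq_zero_of_degree_lt_of_eval_finset_eq_zero
      (B.image fun i => ZMod.stdAddChar (r (σ.symm i))) ?_ ?_
    · rw [Finset.card_image_of_injective]
      · refine (Polynomial.degree_sum_le _ _).trans_lt ?_
        rw [Finset.sup_lt_iff (WithBot.bot_lt_coe _)]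
        exact fun i hi => (degree_monomial_le _ _).trans_lt
          (by exact_mod_cast (hdl i hi).trans_le hcard)
      · exact ZMod.injective_stdAddChar.comp (hr.comp σ.symm.injective)
    · intro z hz
      obtain ⟨i, hi, rfl⟩ := Finset.mem_image.1 hz
      set j := σ.symm i with hj
      have hji : x (σ j) = b := by rw [hj, σ.apply_symm_apply]; exact (Finset.mem_filter.1 hi).2
      have h0 := congrFun hvN j
      simp only [Matrix.vecMul, dotProduct, Matrix.of_apply, Pi.zero_apply, hji, mul_ite,
        mul_zero] at h0
      rw [← Finset.sum_filter] at h0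
      have hB : (Finset.univ.filter fun i => b = x i) = B := by
        simp only [B, eq_comm]
      rw [hB] at h0
      have : ZMod.stdAddChar (r j * a) * p.eval (ZMod.stdAddChar (r j)) = 0 := by
        rw [← h0, eval_finsetSum, Finset.mul_sum]
        refine Finset.sum_congr rfl fun m _ => ?_
        have : ξ m = a + (d m : ZMod n) := by simp [d]
        rw [eval_monomial, ← AddChar.map_nsmul_eq_pow, mul_left_comm, ← AddChar.map_add_eq_mul,
          this, mul_add, nsmul_eq_mul, mul_comm (d m : ZMod n)]
      refine (mul_eq_zero.1 this).resolve_left ?_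
      rw [ZMod.stdAddChar_apply]
      exact Circle.coe_ne_zero _
  have hi₀ : i₀ ∈ B := by simp [B, b]
  have hcoeff : p.coeff (d i₀) = v i₀ := by
    rw [finsetSum_coeff, Finset.sum_eq_single_of_mem i₀ hi₀]
    · simp
    · intro i hi hne
      rw [coeff_monomial, if_neg fun h => hne (hdinj hi hi₀ h)]
  rw [← hcoeff, hp, coeff_zero, Pi.zero_apply]

/-! ### Uniqueness of the maximal-weight assignment -/

/-- The weight of the assignment `j ↦ x (σ j)` of translations to positions. -/
def assignmentWeight {n : ℕ} {ι : Type*} [Fintype ι] (x r : ι → ZMod n)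
    (σ : Equiv.Perm ι) : ℕ :=
  ∑ j, 2 ^ (r j + x (σ j)).val

/-- Otherwise swapping `j` and `j'` creates a residue larger than both old ones, and its power of 2
alone is at least the sum of the two lost powers. This is a stability condition as in stable
matchings. -/
theorem no_blocking_pair_of_weight_max {n : ℕ} [NeZero n] {ι : Type*} [Fintype ι]
    [DecidableEq ι] {x r : ι → ZMod n} {σ : Equiv.Perm ι}
    (hσ : ∀ τ, assignmentWeight x r τ ≤ assignmentWeight x r σ) (j j' : ι)
    (h : (r j + x (σ j)).val < (r j + x (σ j')).val) :
    (r j + x (σ j')).val ≤ (r j' + x (σ j')).val := by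
  by_contra! h'
  have hne : j' ≠ j := by rintro rfl; exact h.ne rfl
  have hj' : j' ∈ Finset.univ.erase j := by simp [hne]
  have key := hσ (Equiv.swap j j' |>.trans σ)
  unfold assignmentWeight at key
  rw [← Finset.add_sum_erase _ _ (Finset.mem_univ j), ← Finset.add_sum_erase _ _ hj',
    ← Finset.add_sum_erase Finset.univ _ (Finset.mem_univ j), ← Finset.add_sum_erase _ _ hj']
    at key
  have hrest : ∑ m ∈ (Finset.univ.erase j).erase j',
      2 ^ (r m + x ((Equiv.swap j j' |>.trans σ) m)).val
      = ∑ m ∈ (Finset.univ.erase j).erase j', 2 ^ (r m + x (σ m)).val := by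
    refine Finset.sum_congr rfl fun m hm => ?_
    simp only [Finset.mem_erase, Finset.mem_univ, and_true] at hm
    rw [Equiv.trans_apply, Equiv.swap_apply_of_ne_of_ne hm.2 hm.1]
  rw [hrest] at key
  simp only [Equiv.trans_apply, Equiv.swap_apply_left, Equiv.swap_apply_right] at key
  have h1 := Nat.pow_le_pow_right (n := 2) (by norm_num) (Nat.succ_le_of_lt h)
  have h2 := Nat.pow_le_pow_right (n := 2) (by norm_num) (Nat.succ_le_of_lt h')
  rw [Nat.succ_eq_add_one, pow_succ] at h1 h2
  have h3 : 0 < 2 ^ (r j' + x (σ j)).val := by positivity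
  omega

/-- Maximal-weight assignments agree at every position: look at the position of disagreement
with the largest residue. -/
theorem assignment_eq_of_weight_max {n : ℕ} [NeZero n] {ι : Type*} [Fintype ι]
    [DecidableEq ι] {x r : ι → ZMod n} (hr : Function.Injective r) {σ τ : Equiv.Perm ι}
    (hσ : ∀ π, assignmentWeight x r π ≤ assignmentWeight x r σ)
    (hτ : ∀ π, assignmentWeight x r π ≤ assignmentWeight x r τ) (j : ι) :
    x (σ j) = x (τ j) := by
  -- Downward induction on the residue: stage `N` handles residues at least `n - N`, for both orders
  -- of the pair `σ`, `τ`.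
  suffices H : ∀ N, ∀ σ τ : Equiv.Perm ι,
      (∀ π, assignmentWeight x r π ≤ assignmentWeight x r σ) →
      (∀ π, assignmentWeight x r π ≤ assignmentWeight x r τ) →
      ∀ j, n ≤ (r j + x (σ j)).val + N → x (σ j) = x (τ j) from
    H n σ τ hσ hτ j (Nat.le_add_left _ _)
  intro N
  induction N with
  | zero =>
    intro σ τ _ _ j hj
    exact absurd (ZMod.val_lt (r j + x (σ j))) (by omega)
  | succ N ih =>
    intro σ τ hσ hτ j hj
    by_contra hne
    by_cases hlt : n ≤ (r j + x (τ j)).val + N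
    · exact hne (ih τ σ hτ hσ j hlt).symm
    have hvalne : (r j + x (τ j)).val ≠ (r j + x (σ j)).val := fun h =>
      hne (add_left_cancel (ZMod.val_injective n h)).symm
    -- every position assigned to the translation `x (σ j)` by `τ` is also assigned to it by `σ`
    have hblock : ∀ i, x i = x (σ j) → x (σ (τ.symm i)) = x (σ j) := by
      intro i hi
      have hstab := no_blocking_pair_of_weight_max hτ j (τ.symm i)
      rw [τ.apply_symm_apply, hi] at hstab
      have hle := hstab (by omega)
      have hne' : (r j + x (σ j)).val ≠ (r (τ.symm i) + x (σ j)).val := fun h => by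
        have hj' : j = τ.symm i := hr (add_right_cancel (ZMod.val_injective n h))
        apply hne
        rw [hj', τ.apply_symm_apply, hi, ← hj']
      have := ih τ σ hτ hσ (τ.symm i) (by rw [τ.apply_symm_apply, hi]; omega)
      rw [← this, τ.apply_symm_apply, hi]
    -- Both assignments use this translation equally often, so `σ` gives it to no position beyond
    -- those of `τ`; hence `j` is one of those.
    let φ : {i // x i = x (σ j)} → {i // x i = x (σ j)} :=
      fun i => ⟨σ (τ.symm i), hblock i i.2⟩
    have hφ : Function.Injective φ := fun i i' h =>
      Subtype.ext (τ.symm.injective (σ.injective (Subtype.mk.inj h)))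
    obtain ⟨i, hi⟩ := Finite.surjective_of_injective hφ ⟨σ j, rfl⟩
    have hij : τ.symm i = j := σ.injective (Subtype.mk.inj hi)
    apply hne
    rw [← hij, τ.apply_symm_apply, i.2, hij]

/-! ### Existence of a good window -/

theorem exists_det_gabor_ne_zero {n : ℕ} [NeZero n] {ι : Type*} [Fintype ι] [DecidableEq ι]
    (x ξ r : ι → ZMod n) (hc : Function.Injective fun i => (x i, ξ i))
    (hr : Function.Injective r)
    (hadj : ∀ b, IsAdjacent {s | (b, s) ∈ Set.range fun i => (x i, ξ i)}) :
    ∃ g : ZMod n → ℂ,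
      (Matrix.of fun i j => g (r j + x i) * ZMod.stdAddChar (r j * ξ i) :
        Matrix ι ι ℂ).det ≠ 0 := by
  obtain ⟨σ, hσ⟩ := Finite.exists_max (assignmentWeight x r)
  let P : ℂ[X] := (Matrix.of fun i j =>
    monomial (2 ^ (r j + x i).val) (ZMod.stdAddChar (r j * ξ i)) : Matrix ι ι ℂ[X]).det
  have hmono : ∀ τ : Equiv.Perm ι,
      ∏ j, monomial (2 ^ (r j + x (τ j)).val) (ZMod.stdAddChar (r j * ξ (τ j)) : ℂ)
        = monomial (assignmentWeight x r τ) (∏ j, ZMod.stdAddChar (r j * ξ (τ j))) := by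
    intro τ
    simp only [assignmentWeight, ← C_mul_X_pow_eq_monomial, Finset.prod_mul_distrib,
      Finset.prod_pow_eq_pow_sum, map_prod]
  have hP : P.coeff (assignmentWeight x r σ) ≠ 0 := by
    -- The terms of maximal weight are exactly those with `x ∘ τ = x ∘ σ`, which are the terms
    -- surviving in the block matrix.
    convert det_block_ne_zero x ξ r hc hr hadj σ using 1
    simp only [P, Matrix.det_apply, finsetSum_coeff, Matrix.of_apply, hmono, coeff_smul,
      coeff_monomial]
    refine Finset.sum_congr rfl fun τ _ => ?_
    congr 1
    split_ifs with h
    · refine Finset.prod_congr rfl fun j _ => ?_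
      rw [if_pos (assignment_eq_of_weight_max hr hσ (fun π => h ▸ hσ π) j)]
    · by_contra hprod
      apply h
      have hj : ∀ j, x (σ j) = x (τ j) := fun j => by
        by_contra hne
        exact hprod (Finset.prod_eq_zero (Finset.mem_univ j) (if_neg hne)).symm
      simp only [assignmentWeight, hj]
  obtain ⟨t, ht⟩ : ∃ t, P.eval t ≠ 0 := by
    by_contra! h
    exact hP (by rw [Polynomial.funext (p := P) (q := 0) (by simpa using h), coeff_zero])
  refine ⟨fun z => t ^ 2 ^ z.val, ?_⟩
  convert ht using 1
  change _ = evalRingHom t P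
  rw [RingHom.map_det]
  congr 1
  ext i j
  simp [eval_monomial, mul_comm]

/-- The Fourier transform turns the column `(x, ξ)` for `g` into the column `(-ξ, x)` for `ZMod.dft
g`, up to a nonzero scalar. Transforming a kernel relation needs it at every position, whence the
bijectivity of `r`. -/
theorem exists_det_gabor_ne_zero_of_adjacent_translations {n : ℕ} [NeZero n] {ι : Type*}
    [Fintype ι] [DecidableEq ι] (x ξ r : ι → ZMod n)
    (hc : Function.Injective fun i => (x i, ξ i)) (hr : Function.Bijective r)
    (hadj : ∀ b, IsAdjacent {s | (s, b) ∈ Set.range fun i => (x i, ξ i)}) :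
    ∃ g : ZMod n → ℂ,
      (Matrix.of fun i j => g (r j + x i) * ZMod.stdAddChar (r j * ξ i) :
        Matrix ι ι ℂ).det ≠ 0 := by
  obtain ⟨g', hg'⟩ := exists_det_gabor_ne_zero (fun i => -ξ i) x r
    (fun i j h => hc (by simpa [and_comm] using h)) hr.1 (fun b => by
      convert hadj (-b) using 1
      ext s
      simp only [Set.mem_ofPred_eq, Set.mem_range, Prod.mk.injEq, neg_eq_iff_eq_neg, and_comm])
  refine ⟨ZMod.dft.symm g', fun hdet => hg' ?_⟩
  set g := ZMod.dft.symm g' with hg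
  have hgg : ZMod.dft g = g' := by rw [hg, LinearEquiv.apply_symm_apply]
  obtain ⟨v, hv, hvN⟩ := Matrix.exists_vecMul_eq_zero_iff.2 hdet
  rw [← Matrix.exists_vecMul_eq_zero_iff]
  have hzero : ∀ y, ∑ i, v i * (g (y + x i) * ZMod.stdAddChar (y * ξ i)) = 0 := by
    intro y
    obtain ⟨j, rfl⟩ := hr.2 y
    exact congrFun hvN j
  have hne : ∀ z : ZMod n, (ZMod.stdAddChar z : ℂ) ≠ 0 := fun z => by
    rw [ZMod.stdAddChar_apply]
    exact Circle.coe_ne_zero _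
  refine ⟨fun i => v i * ZMod.stdAddChar (-(x i * ξ i)), fun h => hv ?_, ?_⟩
  · funext i
    exact (mul_eq_zero.1 (congrFun h i)).resolve_right (hne _)
  funext j
  set η := r j with hη
  have hdft : ∀ i, ∑ y, ZMod.stdAddChar (-(y * η)) * (g (y + x i) * ZMod.stdAddChar (y * ξ i))
      = ZMod.stdAddChar (-(x i * ξ i)) * (g' (η + -ξ i) * ZMod.stdAddChar (η * x i)) := by
    intro i
    rw [← hgg, ZMod.dft_apply,
      ← Equiv.sum_comp (Equiv.addRight (x i)) fun u => ZMod.stdAddChar (-(u * (η + -ξ i))) • g u,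
      Finset.sum_mul, Finset.mul_sum]
    refine Finset.sum_congr rfl fun y _ => ?_
    simp only [Equiv.coe_addRight, smul_eq_mul]
    have : (ZMod.stdAddChar (-(y * η)) : ℂ) * ZMod.stdAddChar (y * ξ i)
        = ZMod.stdAddChar (-(x i * ξ i)) * ZMod.stdAddChar (-((y + x i) * (η + -ξ i)))
          * ZMod.stdAddChar (η * x i) := by
      rw [← AddChar.map_add_eq_mul, ← AddChar.map_add_eq_mul, ← AddChar.map_add_eq_mul]
      congr 1
      ring
    linear_combination g (y + x i) * this
  have hsum : ∑ y, ZMod.stdAddChar (-(y * η)) *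
      ∑ i, v i * (g (y + x i) * ZMod.stdAddChar (y * ξ i)) = 0 := by simp [hzero]
  simp only [Finset.mul_sum] at hsum
  rw [Finset.sum_comm] at hsum
  simp only [Matrix.vecMul, dotProduct, Matrix.of_apply, Pi.zero_apply]
  rw [← hsum]
  refine Finset.sum_congr rfl fun i _ => ?_
  rw [mul_assoc, ← hη, ← hdft, Finset.mul_sum]
  exact Finset.sum_congr rfl fun y _ => by ring

theorem ae_det_gaborMatrix_ne_zero_of_exists {n : ℕ} [NeZero n] {ι : Type*} [Fintype ι]
    [DecidableEq ι] (c : ι → ZMod n × ZMod n) (r : ι → ZMod n)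
    (h : ∃ g : ZMod n → ℂ,
      (Matrix.of fun i j => g (r j + (c i).1) * ZMod.stdAddChar (r j * (c i).2) :
        Matrix ι ι ℂ).det ≠ 0) :
    ∀ᵐ g : ZMod n → ℂ ∂MeasureTheory.volume, ((gaborMatrix g).submatrix c r).det ≠ 0 := by
  obtain ⟨g₀, h₀⟩ := h
  let L : (ZMod n → ℂ) →ₗ[ℂ] Matrix ι ι ℂ :=
    { toFun := fun g => Matrix.of fun i j =>
        g (r j + (c i).1) * ZMod.stdAddChar (r j * (c i).2)
      map_add' := fun g g' => by ext; simp [add_mul]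
      map_smul' := fun t g => by ext; simp [mul_assoc] }
  filter_upwards [ae_det_ne_zero_of_exists L g₀ h₀] with g hg
  rw [det_gaborMatrix_submatrix, star_ne_zero, ← Matrix.det_transpose]
  convert hg using 2
  ext i j
  exact gaborColumns_apply g (r j) (c i).1 (c i).2

end FiniteGabor

theorem mainTheorem10 (n : ℕ) [NeZero n] :
    (∀ (k : ℕ) (c : Fin k ↪ ZMod n × ZMod n) (r : Fin k ↪ ZMod n),
      (∀ x : ZMod n, FiniteGabor.IsAdjacent {ξ : ZMod n | (x, ξ) ∈ Set.range c}) →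
        ∀ᵐ g : ZMod n → ℂ ∂MeasureTheory.volume,
          ((FiniteGabor.gaborMatrix g).submatrix c r).det ≠ 0) ∧
    (∀ (c : Fin n ↪ ZMod n × ZMod n) (r : Fin n ↪ ZMod n),
      (∀ ξ : ZMod n, FiniteGabor.IsAdjacent {x : ZMod n | (x, ξ) ∈ Set.range c}) →
        ∀ᵐ g : ZMod n → ℂ ∂MeasureTheory.volume,
          ((FiniteGabor.gaborMatrix g).submatrix c r).det ≠ 0) := by
  refine ⟨fun k c r hadj => ?_, fun c r hadj => ?_⟩
  · exact FiniteGabor.ae_det_gaborMatrix_ne_zero_of_exists c r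
      (FiniteGabor.exists_det_gabor_ne_zero (fun i => (c i).1) (fun i => (c i).2) r
        c.injective r.injective hadj)
  · have hr : Function.Bijective r :=
      (Fintype.bijective_iff_injective_and_card r).2 ⟨r.injective, by simp [ZMod.card]⟩
    exact FiniteGabor.ae_det_gaborMatrix_ne_zero_of_exists c r
      (FiniteGabor.exists_det_gabor_ne_zero_of_adjacent_translations (fun i => (c i).1)
        (fun i => (c i).2) r c.injective hr hadj)
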